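/- **Setting.** Work in $\mathbb{R}^n$ with the lattice $\mathbb{Z}^n$ (the Helly system $[\mathbb{Z}^n,\{C\cap\mathbb{Z}^n : C \text{ convex}\}]$ embedded in $[\mathbb{R}^n,\mathcal{K}^\star]$, $\mathcal{K}^\star$ the convex subsets of $\mathbb{R}^n$). A *valid disjunction* is a finite list of convex sets covering $\mathbb{Z}^n$; the *split disjunctions* are the pairs $\{x:\langle\alpha,x\rangle\le\beta\},\ \{x:\langle\alpha,x\rangle\ge\beta+1\}$ with $\alpha\in\mathbb{Z}^n\setminus\{0\}$, $\beta\in\mathbb{Z}$. A *valid halfspace* for $K\cap\mathbb{Z}^n$ is a convex set $H\supseteq K\cap\mathbb{Z}^n$ whose complement $H^c=\mathbb{R}^n\setminus H$ is convex. Fix a family of disjunctions that may be used, a cutting plane paradigm (for each finite list $\mathcal{L}$ of subsets of $\mathbb{R}^n$, a family of halfspaces that may be used as cuts), and a notion of certificate of infeasibility (objects with a size in $\{0,1,2,\dots\}$, each of which certifies certain finite lists of sets; a certified list has no integer point in its intersection). Assume that inserting further sets into a list never hurts: cuts that may be used for the list may still be used, and a certificate for the list yields a certificate of no larger size for the longer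 list. A *branch-and-cut tree* with root label $\mathcal{L}_0$ (a finite list of convex sets) is a finite rooted tree in which every node has a label, a finite list of convex sets, that of the root being $\mathcal{L}_0$, and in which each internal node, with label $\mathcal{L}$ say, either * carries a valid disjunction $K_1,\dots,K_p$ that may be used, and has $p$ children, with labels $\mathcal{L}\cup\{K_i\}$; or * carries a halfspace $H$ that may be used as a cut for $\mathcal{L}$ and is valid for $\bigcap\mathcal{L}\cap\mathbb{Z}^n$, and has two children: one with label $\mathcal{L}\cup\{H\}$, and a leaf, called a *cutting plane certifier*, that carries a certificate of infeasibility for $\mathcal{L}\cup\{H^c\}$. Its *size* is the number of its nodes plus the sizes of all certificates at cutting plane certifiers. Let $Q$ be the union of the sets $\bigcap\mathcal{L}$ over the labels $\mathcal{L}$ of all leaves that are not cutting plane certifiers. The tree *certifies* a point $x$ if $x\notin\operatorname{conv}(Q)$, and it *certifies* a halfspace $H$ if $Q\subseteq H$. Let $P'=\bigcap\mathcal{L}_0$, $P=P'\cap\mathbb{Z}^n$, $P_I=\operatorname{conv}(P)$. With respect to $\mathcal{L}_0$, the *membership complexity* of $P$ is the maximum over $x\notin P_I$ of the least size of a branch-and-cut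 tree with root label $\mathcal{L}_0$ certifying $x$; the *facet complexity* of $P$ is the maximum over the facets of $P_I$ of the minimum, over the closed halfspaces $\{x:\langle a,x\rangle\le b\}$ defining the facet, of the least size of a branch-and-cut tree with root label $\mathcal{L}_0$ certifying that halfspace. Both take values in $\{0,1,2,\dots\}\cup\{\infty\}$, with minimum $\infty$ if there is no such tree, maximum $\infty$ if the values are unbounded, and maximum $0$ over the empty set. **Theorem.** Suppose that $P'$ is a polyhedron that is rational or bounded, that $P_I$ is a full-dimensional rational polytope, and that all split disjunctions may be used. Then $$\text{membership complexity of }P\ \le\ \text{facet complexity of }P\ \le\ \text{membership complexity of }P+2 .$$ -/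

import Mathlib

universe u

/-- The integer lattice `ℤⁿ`, as a subset of `ℝⁿ`. -/
def intPoints (n : ℕ) : Set (Fin n → ℝ) :=
  Set.range fun (z : Fin n → ℤ) (i : Fin n) => (z i : ℝ)

/-- The closed set `{x : ⟨a, x⟩ ≤ b}`. -/
def closedHalfspace {n : ℕ} (a : Fin n → ℝ) (b : ℝ) : Set (Fin n → ℝ) :=
  {x | dotProduct a x ≤ b}

/-- A polyhedron: the solution set of finitely many (real) linear inequalities. -/
def IsPolyhedron {n : ℕ} (C : Set (Fin n → ℝ)) : Prop :=
  ∃ (m : ℕ) (A : Fin m → Fin n → ℝ) (b : Fin m → ℝ),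
    C = {x | ∀ j, dotProduct (A j) x ≤ b j}

/-- A rational polyhedron: the solution set of finitely many linear inequalities with rational
coefficients and rational right-hand sides. -/
def IsRationalPolyhedron {n : ℕ} (C : Set (Fin n → ℝ)) : Prop :=
  ∃ (m : ℕ) (A : Fin m → Fin n → ℚ) (b : Fin m → ℚ),
    C = {x | ∀ j, dotProduct (fun i => (A j i : ℝ)) x ≤ (b j : ℝ)}

/-- A rational polytope: a bounded rational polyhedron. -/
def IsRationalPolytope {n : ℕ} (C : Set (Fin n → ℝ)) : Prop :=
  IsRationalPolyhedron C ∧ Bornology.IsBounded C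

/-- The inequality `⟨a, x⟩ ≤ b`, with `a ≠ 0`, is valid for `C` and holds with equality
exactly on the subset `F` of `C`. -/
def DefinesFace {n : ℕ} (C : Set (Fin n → ℝ)) (a : Fin n → ℝ) (b : ℝ)
    (F : Set (Fin n → ℝ)) : Prop :=
  a ≠ 0 ∧ C ⊆ closedHalfspace a b ∧ F = {x ∈ C | dotProduct a x = b}

/-- `F` is a facet of the polyhedron `C`: a nonempty face whose dimension is one less than
that of `C`. -/
def IsFacet {n : ℕ} (C F : Set (Fin n → ℝ)) : Prop :=
  F.Nonempty ∧ (∃ a b, DefinesFace C a b F) ∧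
    Module.finrank ℝ (vectorSpan ℝ F) + 1 = Module.finrank ℝ (vectorSpan ℝ C)

/-- The intersection of all the sets in a list (all of `ℝⁿ` for the empty list). -/
def listInter {n : ℕ} (L : List (Set (Fin n → ℝ))) : Set (Fin n → ℝ) :=
  {x | ∀ K ∈ L, x ∈ K}

/-- Valid disjunctions for the Helly system of lattice-convex subsets of `ℤⁿ` inside that of
convex subsets of `ℝⁿ`: finitely many convex sets that together cover `ℤⁿ`. -/
def IsValidDisjunction {n : ℕ} (D : List (Set (Fin n → ℝ))) : Prop :=
  (∀ K ∈ D, Convex ℝ K) ∧ ∀ z ∈ intPoints n, ∃ K ∈ D, z ∈ K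

/-- Halfspaces of the Helly system of convex subsets of `ℝⁿ`: convex sets whose complement
is convex. -/
def IsHellyHalfspace {n : ℕ} (H : Set (Fin n → ℝ)) : Prop :=
  Convex ℝ H ∧ Convex ℝ Hᶜ

/-- `H` is a valid halfspace for the set of integer points of `K`. -/
def IsValidHalfspace {n : ℕ} (K H : Set (Fin n → ℝ)) : Prop :=
  IsHellyHalfspace H ∧ K ∩ intPoints n ⊆ H

/-- The split disjunction `{x : ⟨α, x⟩ ≤ β} ∪ {x : ⟨α, x⟩ ≥ β + 1}`. -/
def splitDisjunction {n : ℕ} (α : Fin n → ℤ) (β : ℤ) : List (Set (Fin n → ℝ)) :=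
  [{x | dotProduct (fun i => (α i : ℝ)) x ≤ (β : ℝ)},
   {x | (β : ℝ) + 1 ≤ dotProduct (fun i => (α i : ℝ)) x}]

/-- The choices relative to which branch-and-cut trees are formed: a branching scheme, a
cutting plane paradigm and a notion of certificate of infeasibility. -/
structure BranchAndCutScheme (n : ℕ) where
  /-- The disjunctions that may be used. -/
  disjunctions : Set (List (Set (Fin n → ℝ)))
  /-- The halfspaces that may be used as cutting planes at a node with a given first label. -/
  cuts : List (Set (Fin n → ℝ)) → Set (Set (Fin n → ℝ))
  /-- The certificates of infeasibility. -/
  Cert : Type u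
  /-- The size of a certificate of infeasibility. -/
  certSize : Cert → ℕ
  /-- `Certifies c L`: the certificate `c` proves that no integer point lies in all sets
  of the list `L`. -/
  Certifies : Cert → List (Set (Fin n → ℝ)) → Prop
  /-- Only infeasible systems have certificates of infeasibility. -/
  sound : ∀ c L, Certifies c L → listInter L ∩ intPoints n = ∅

/-- All split disjunctions may be used. -/
def BranchAndCutScheme.AllowsSplits {n : ℕ} (S : BranchAndCutScheme.{u} n) : Prop :=
  ∀ (α : Fin n → ℤ) (β : ℤ), α ≠ 0 → splitDisjunction α β ∈ S.disjunctions

/-- Additional constraints do no harm: a cutting plane that may be used for a system of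
constraints may still be used, and a certificate of infeasibility for the system yields one that
is not larger, after further constraints have been inserted into the system. -/
def BranchAndCutScheme.IsMonotone {n : ℕ} (S : BranchAndCutScheme.{u} n) : Prop :=
  ∀ L L' : List (Set (Fin n → ℝ)), L.Sublist L' →
    S.cuts L ⊆ S.cuts L' ∧
    ∀ c, S.Certifies c L → ∃ c', S.Certifies c' L' ∧ S.certSize c' ≤ S.certSize c

/-- The shape of a branch-and-cut tree together with the second labels of its nodes. The first
labels are determined by these and by the first label of the root. A node `cut H c t` has two
children: the left child is a leaf (the cutting plane certifier) that carries the certificate `c`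
and is not represented separately; the right child is the root of `t`. -/
inductive BCTree (n : ℕ) (Cert : Type u) : Type u
  | leaf : BCTree n Cert
  | branch (D : List (Set (Fin n → ℝ))) (child : Fin D.length → BCTree n Cert) : BCTree n Cert
  | cut (H : Set (Fin n → ℝ)) (c : Cert) (t : BCTree n Cert) : BCTree n Cert

namespace BCTree

variable {n : ℕ}

/-- `t.IsTree S L`: the tree `t`, with first label `L` at its root, is a branch-and-cut tree
for the scheme `S`. -/
def IsTree (S : BranchAndCutScheme.{u} n) :
    BCTree n S.Cert → List (Set (Fin n → ℝ)) → Prop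
  | leaf, _ => True
  | branch D child, L =>
      D ∈ S.disjunctions ∧ IsValidDisjunction D ∧ ∀ i, IsTree S (child i) (D.get i :: L)
  | cut H c t, L =>
      H ∈ S.cuts L ∧ IsValidHalfspace (listInter L) H ∧ S.Certifies c (Hᶜ :: L) ∧
        IsTree S t (H :: L)

/-- The size: the number of nodes plus the sizes of the certificates of infeasibility at the
cutting plane certifiers. A node with a cutting plane accounts for itself, for its left child
and for the certificate there. -/
def size {Cert : Type u} (certSize : Cert → ℕ) : BCTree n Cert → ℕ
  | leaf => 1
  | branch _ child => 1 + ∑ i, size certSize (child i)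
  | cut _ c t => 1 + (1 + certSize c) + size certSize t

/-- The union, over all leaves that are not cutting plane certifiers, of the intersection of the
sets in the first label of the leaf, where `L` is the first label of the root. -/
def leafUnion {Cert : Type u} : BCTree n Cert → List (Set (Fin n → ℝ)) → Set (Fin n → ℝ)
  | leaf, L => listInter L
  | branch D child, L => ⋃ i, leafUnion (child i) (D.get i :: L)
  | cut H _ t, L => leafUnion t (H :: L)

end BCTree

namespace BranchAndCutScheme

variable {n : ℕ}

/-- The integer hull `P_I = conv(P)`, where `P` is the set of integer points of the
intersection of the list `L`. -/
def integerHull (L : List (Set (Fin n → ℝ))) : Set (Fin n → ℝ) :=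
  convexHull ℝ (listInter L ∩ intPoints n)

/-- The membership complexity of a point `x` with respect to the relaxation `L`: the least size
of a branch-and-cut tree with first label `L` at its root such that `x` is not in the convex hull
of the union of the sets at its leaves; `⊤` if there is no such tree. -/
noncomputable def pointMembershipComplexity (S : BranchAndCutScheme.{u} n)
    (L : List (Set (Fin n → ℝ))) (x : Fin n → ℝ) : ℕ∞ :=
  ⨅ (t : BCTree n S.Cert) (_ : t.IsTree S L ∧ x ∉ convexHull ℝ (t.leafUnion L)),
    (t.size S.certSize : ℕ∞)

/-- The membership complexity: the maximum over all points outside the integer hull. -/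
noncomputable def membershipComplexity (S : BranchAndCutScheme.{u} n)
    (L : List (Set (Fin n → ℝ))) : ℕ∞ :=
  ⨆ (x : Fin n → ℝ) (_ : x ∉ integerHull L), S.pointMembershipComplexity L x

/-- The validity complexity of a halfspace `H` with respect to the relaxation `L`: the least size
of a branch-and-cut tree with first label `L` at its root all of whose leaves have their sets
contained in `H`; `⊤` if there is no such tree. -/
noncomputable def validityComplexity (S : BranchAndCutScheme.{u} n)
    (L : List (Set (Fin n → ℝ))) (H : Set (Fin n → ℝ)) : ℕ∞ :=
  ⨅ (t : BCTree n S.Cert) (_ : t.IsTree S L ∧ t.leafUnion L ⊆ H), (t.size S.certSize : ℕ∞)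

/-- The facet complexity: the maximum, over all facets of the integer hull, of the minimum of the
validity complexities of the halfspaces that define the facet. -/
noncomputable def facetComplexity (S : BranchAndCutScheme.{u} n)
    (L : List (Set (Fin n → ℝ))) : ℕ∞ :=
  ⨆ (F : Set (Fin n → ℝ)) (_ : IsFacet (integerHull L) F),
    ⨅ (a : Fin n → ℝ) (b : ℝ) (_ : DefinesFace (integerHull L) a b F),
      S.validityComplexity L (closedHalfspace a b)

end BranchAndCutScheme

/-! Membership ≤ facet: a point outside the full-dimensional polyhedron P_I violates some facet,
whichever inequality represents it (`IsPolyhedron.exists_isFacet_of_notMem`). A tree whose leaves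
satisfy such an inequality therefore separates the point from the convex hull of the leaves.

Facet ≤ membership + 2: since the vertices of P_I are integral, a facet F has an integral inequality
⟨α, x⟩ ≤ β (`DefinesFace.exists_int`). Branch at the root on the split (α, β). The left child is a
leaf where the inequality holds. Since P' is bounded, some x just beyond F lies in conv(F ∪ {q}) for
every q ∈ P' with ⟨α, q⟩ ≥ β + 1 (`exists_mem_convexHull_insert`). Take a tree certifying this
single x and transport it by monotonicity to the right child. Trees never lose integer points, so F
lies in the convex hull of the leaves of the original tree; a point q surviving in the right subtree
would also lie in those leaves and force x into that hull. Hence nothing survives on the right, and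
the extra cost is the root and the left leaf.

Boundedness of P' in the rational case: an unbounded rational polyhedron containing an integer point
contains infinitely many along an integral recession direction, which contradicts boundedness of
P_I. -/

open Filter Topology

/-! ### Facets of full-dimensional polyhedra. -/

section Hyperplanes

variable {n : ℕ}

theorem dotProduct_self_pos_of_ne_zero {a : Fin n → ℝ} (ha : a ≠ 0) : 0 < dotProduct a a := by
  have h : 0 ≤ dotProduct a a := Finset.sum_nonneg fun i _ => mul_self_nonneg (a i)
  exact lt_of_le_of_ne h fun h0 => ha (dotProduct_self_eq_zero.1 h0.symm)

theorem continuous_dotProduct_right (a : Fin n → ℝ) :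
    Continuous fun x : Fin n → ℝ => dotProduct a x := by
  unfold dotProduct; fun_prop

/-- The linear hyperplane orthogonal to `a`. -/
noncomputable def orthHyperplane (a : Fin n → ℝ) : Submodule ℝ (Fin n → ℝ) :=
  LinearMap.ker (dotProductBilin ℝ ℝ a)

theorem mem_orthHyperplane {a v : Fin n → ℝ} : v ∈ orthHyperplane a ↔ dotProduct a v = 0 :=
  Iff.rfl

theorem finrank_orthHyperplane {a : Fin n → ℝ} (ha : a ≠ 0) :
    Module.finrank ℝ (orthHyperplane a) + 1 = n := by
  have h := Module.Dual.finrank_ker_add_one_of_ne_zero (K := ℝ) (V₁ := Fin n → ℝ)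
    (f := dotProductBilin ℝ ℝ a) (fun h => (dotProduct_self_pos_of_ne_zero ha).ne'
      (by simpa using LinearMap.congr_fun h a))
  rw [Module.finrank_fin_fun] at h
  exact h

theorem vectorSpan_le_orthHyperplane {F : Set (Fin n → ℝ)} {a : Fin n → ℝ} {b : ℝ}
    (hF : ∀ x ∈ F, dotProduct a x = b) : vectorSpan ℝ F ≤ orthHyperplane a := by
  rw [vectorSpan_def, Submodule.span_le]
  rintro _ ⟨x, hx, y, hy, rfl⟩
  simp [mem_orthHyperplane, dotProduct_sub, hF x hx, hF y hy]

theorem finrank_vectorSpan_of_affineSpan_eq_top {C : Set (Fin n → ℝ)}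
    (hC : affineSpan ℝ C = ⊤) : Module.finrank ℝ (vectorSpan ℝ C) = n := by
  rw [← direction_affineSpan, hC, AffineSubspace.direction_top, finrank_top]
  simp

theorem IsRationalPolyhedron.isPolyhedron {C : Set (Fin n → ℝ)} (h : IsRationalPolyhedron C) :
    IsPolyhedron C := by
  obtain ⟨m, A, b, rfl⟩ := h
  exact ⟨m, fun j i => A j i, fun j => b j, rfl⟩

/-- An interior point of a set satisfies each nontrivial valid inequality strictly. -/
theorem dotProduct_lt_of_mem_interior {C : Set (Fin n → ℝ)} {a y : Fin n → ℝ} {b : ℝ}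
    (ha : a ≠ 0) (hC : C ⊆ closedHalfspace a b) (hy : y ∈ interior C) : dotProduct a y < b := by
  have h1 : Tendsto (fun t : ℝ => y + t • a) (𝓝[>] 0) (𝓝 y) := by
    have : Continuous fun t : ℝ => y + t • a := by fun_prop
    simpa using (this.tendsto 0).mono_left nhdsWithin_le_nhds
  obtain ⟨t, ht, ht0⟩ := ((h1.eventually (mem_interior_iff_mem_nhds.1 hy)).and
    self_mem_nhdsWithin).exists
  have h2 : dotProduct a (y + t • a) ≤ b := hC ht
  rw [dotProduct_add, dotProduct_smul, smul_eq_mul] at h2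
  have := mul_pos (show 0 < t from ht0) (dotProduct_self_pos_of_ne_zero ha)
  linarith

/-- A point outside a full-dimensional polyhedron violates a facet, whichever inequality is used
to define that facet. -/
theorem IsPolyhedron.exists_isFacet_of_notMem {C : Set (Fin n → ℝ)} (hC : IsPolyhedron C)
    (hconv : Convex ℝ C) (hfull : affineSpan ℝ C = ⊤) {x : Fin n → ℝ} (hx : x ∉ C) :
    ∃ F, IsFacet C F ∧ ∀ a b, DefinesFace C a b F → x ∉ closedHalfspace a b := by
  classical
  obtain ⟨m, A, b, hAb⟩ := hC
  -- In a minimal subsystem describing C no inequality is redundant, so each of them defines a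
  -- facet.
  obtain ⟨J, hJ, hmin⟩ := exists_minimal_of_wellFoundedLT
    (fun J : Finset (Fin m) => C = {x | ∀ j ∈ J, dotProduct (A j) x ≤ b j})
    ⟨Finset.univ, by simpa using hAb⟩
  have hsub : ∀ j ∈ J, C ⊆ closedHalfspace (A j) (b j) := fun j hj u hu => by
    rw [hJ] at hu
    exact hu j hj
  have hxJ : ∃ j ∈ J, b j < dotProduct (A j) x := by
    rw [hJ] at hx
    simpa using hx
  obtain ⟨j, hj, hxj⟩ := hxJ
  have hred : ∀ i ∈ J, ∃ z, (∀ k ∈ J, k ≠ i → dotProduct (A k) z ≤ b k) ∧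
      b i < dotProduct (A i) z := by
    intro i hi
    by_contra! hcon
    refine Finset.notMem_erase i J (hmin (y := J.erase i) ?_ (Finset.erase_subset _ _) hi)
    refine Set.Subset.antisymm (fun u hu k hk => hsub k (Finset.mem_of_mem_erase hk) hu) ?_
    intro u hu
    rw [hJ]
    have hu' : ∀ k ∈ J, k ≠ i → dotProduct (A k) u ≤ b k :=
      fun k hk hki => hu k (Finset.mem_erase.2 ⟨hki, hk⟩)
    intro k hk
    by_cases hki : k = i
    · subst hki
      exact hcon u hu'
    · exact hu' k hk hki
  obtain ⟨y, hy⟩ := (hconv.interior_nonempty_iff_affineSpan_eq_top).2 hfull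
  have hyC : y ∈ C := interior_subset hy
  have hA0 : ∀ i ∈ J, A i ≠ 0 := by
    intro i hi h0
    obtain ⟨z, -, hz⟩ := hred i hi
    have := hsub i hi hyC
    simp only [closedHalfspace, Set.mem_ofPred_eq, h0, zero_dotProduct] at this hz
    linarith
  have hylt : ∀ i ∈ J, dotProduct (A i) y < b i := fun i hi =>
    dotProduct_lt_of_mem_interior (hA0 i hi) (hsub i hi) hy
  obtain ⟨z, hz, hzj⟩ := hred j hj
  have hyj := hylt j hj
  -- The point where the segment from the interior point y to z crosses the j-th hyperplane. As t <
  -- 1, strictness of the other inequalities at y carries over.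
  obtain ⟨w, hwj, hw⟩ : ∃ w, dotProduct (A j) w = b j ∧
      ∀ k ∈ J, k ≠ j → dotProduct (A k) w < b k := by
    have hpos : 0 < dotProduct (A j) z - dotProduct (A j) y := by linarith
    set t := (b j - dotProduct (A j) y) / (dotProduct (A j) z - dotProduct (A j) y) with ht
    have ht0 : 0 ≤ t := div_nonneg (by linarith) hpos.le
    have ht1 : t < 1 := (div_lt_one hpos).2 (by linarith)
    refine ⟨y + t • (z - y), ?_, fun k hk hkj => ?_⟩
    · rw [dotProduct_add, dotProduct_smul, dotProduct_sub, smul_eq_mul, ht,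
        div_mul_cancel₀ _ hpos.ne']
      ring
    · rw [dotProduct_add, dotProduct_smul, dotProduct_sub, smul_eq_mul]
      nlinarith [hylt k hk, hz k hk hkj]
  have hmem : ∀ u, dotProduct (A j) u = b j → (∀ k ∈ J, k ≠ j → dotProduct (A k) u < b k) →
      u ∈ C := by
    intro u huj hu
    rw [hJ]
    intro k hk
    by_cases hkj : k = j
    · rw [hkj, huj]
    · exact (hu k hk hkj).le
  set F := {u ∈ C | dotProduct (A j) u = b j} with hF
  have hwF : w ∈ F := ⟨hmem w hwj hw, hwj⟩
  have hle : vectorSpan ℝ F ≤ orthHyperplane (A j) :=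
    vectorSpan_le_orthHyperplane fun u hu => hu.2
  -- All other inequalities are strict at w, so w can be moved slightly in any direction of the
  -- hyperplane without leaving F.
  have hge : orthHyperplane (A j) ≤ vectorSpan ℝ F := by
    intro v hv
    have hev : ∀ᶠ s : ℝ in 𝓝[>] 0, ∀ k ∈ J, k ≠ j → dotProduct (A k) (w + s • v) < b k := by
      rw [Filter.eventually_all_finset]
      intro k hk
      by_cases hkj : k = j
      · simp [hkj]
      have hcont : Continuous fun s : ℝ => dotProduct (A k) (w + s • v) :=
        (continuous_dotProduct_right _).comp (by fun_prop)
      have := (hcont.tendsto 0).eventually (gt_mem_nhds (by simpa using hw k hk hkj))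
      filter_upwards [nhdsWithin_le_nhds this] with s hs _ using hs
    obtain ⟨s, hs, hs0⟩ := (hev.and self_mem_nhdsWithin).exists
    have hs0 : 0 < s := hs0
    have hwv : dotProduct (A j) (w + s • v) = b j := by
      rw [dotProduct_add, dotProduct_smul, mem_orthHyperplane.1 hv, hwj]; simp
    have := vsub_mem_vectorSpan ℝ (show w + s • v ∈ F from ⟨hmem _ hwv hs, hwv⟩) hwF
    rw [vsub_eq_sub, add_sub_cancel_left] at this
    exact (Submodule.smul_mem_iff _ hs0.ne').1 this
  refine ⟨F, ⟨⟨w, hwF⟩, ⟨A j, b j, hA0 j hj, hsub j hj, rfl⟩, ?_⟩, ?_⟩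
  · rw [finrank_vectorSpan_of_affineSpan_eq_top hfull, le_antisymm hle hge]
    exact finrank_orthHyperplane (hA0 j hj)
  -- Modulo the hyperplane direction, on which a' vanishes too, x - w equals t(y - w) with t < 0.
  -- Since y satisfies the new inequality strictly and w tightly, x violates it.
  · rintro a' b' ⟨-, hC', hF'⟩ hxa
    have hF'' : ∀ u ∈ F, dotProduct a' u = b' := fun u hu => by
      rw [hF'] at hu
      exact hu.2
    have hker : orthHyperplane (A j) ≤ orthHyperplane a' :=
      hge.trans (vectorSpan_le_orthHyperplane hF'')
    have hwb := hF'' w hwF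
    have hyb : dotProduct a' y < b' := by
      refine lt_of_le_of_ne (hC' hyC) fun h => ?_
      have : y ∈ F := by
        rw [hF']
        exact ⟨hyC, h⟩
      exact hyj.ne this.2
    have hneg : dotProduct (A j) y - b j < 0 := by linarith
    set t := (dotProduct (A j) x - b j) / (dotProduct (A j) y - b j) with ht
    have ht0 : t < 0 := div_neg_of_pos_of_neg (by linarith) hneg
    have hv : x - w - t • (y - w) ∈ orthHyperplane (A j) := by
      rw [mem_orthHyperplane, dotProduct_sub, dotProduct_sub, dotProduct_smul, dotProduct_sub,
        hwj, smul_eq_mul, ht, div_mul_cancel₀ _ hneg.ne, sub_self]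
    have h := mem_orthHyperplane.1 (hker hv)
    rw [dotProduct_sub, dotProduct_sub, dotProduct_smul, dotProduct_sub, hwb, smul_eq_mul] at h
    have hxa : dotProduct a' x ≤ b' := hxa
    nlinarith

end Hyperplanes

/-- Halfspaces are convex, so leaves inside a halfspace missing `x` have a convex hull missing `x`.
The facet complexity lets the inequality be chosen freely, which is why the violated facet must be
violated in every representation. -/
theorem BranchAndCutScheme.membershipComplexity_le_facetComplexity {n : ℕ}
    (S : BranchAndCutScheme.{u} n) (L : List (Set (Fin n → ℝ)))
    (hhull : IsPolyhedron (integerHull L)) (hfull : affineSpan ℝ (integerHull L) = ⊤) :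
    S.membershipComplexity L ≤ S.facetComplexity L := by
  refine iSup₂_le fun x hx => ?_
  obtain ⟨F, hF, hFx⟩ := hhull.exists_isFacet_of_notMem (convex_convexHull ℝ _) hfull hx
  refine le_trans ?_ (le_iSup₂ (f := fun F (_ : IsFacet (integerHull L) F) =>
    ⨅ (a : Fin n → ℝ) (b : ℝ) (_ : DefinesFace (integerHull L) a b F),
      S.validityComplexity L (closedHalfspace a b)) F hF)
  refine le_iInf fun a => le_iInf₂ fun b hab => le_iInf₂ fun t ht => ?_
  refine iInf₂_le t ⟨ht.1, fun hxt => hFx a b hab ?_⟩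
  refine convexHull_min ht.2 ?_ hxt
  exact convex_halfSpace_le (dotProductBilin ℝ ℝ a).isLinear b

/-! ### Integral directions, boundedness and integral facet inequalities. -/

section Rational

/-- A nonzero real vector can be replaced by a nonzero integral one without changing the signs of
finitely many nonpositive values of rational linear forms. -/
theorem exists_int_vector_of_dotProduct_nonpos {n : ℕ} {ι : Type*} [Finite ι]
    (A : ι → Fin n → ℚ) {d : Fin n → ℝ} (hd : d ≠ 0) :
    ∃ e : Fin n → ℤ, e ≠ 0 ∧ ∀ j,
      (dotProduct (fun i => (A j i : ℝ)) d = 0 →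
        dotProduct (fun i => (A j i : ℝ)) (fun i => (e i : ℝ)) = 0) ∧
      (dotProduct (fun i => (A j i : ℝ)) d < 0 →
        dotProduct (fun i => (A j i : ℝ)) (fun i => (e i : ℝ)) < 0) := by
  classical
  -- The coordinates of d are expanded in a basis r of their ℚ-span. A rational form vanishing at d
  -- has zero coefficients in r, so it still vanishes when r is moved; strict signs survive small
  -- moves. So r can be moved to a rational vector and denominators cleared.
  let V := Submodule.span ℚ (Set.range d)
  have : FiniteDimensional ℚ V := FiniteDimensional.span_of_finite ℚ (Set.finite_range d)
  let B := Module.finBasis ℚ V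
  let r : Fin (Module.finrank ℚ V) → ℝ := fun k => (B k : ℝ)
  have hr : LinearIndependent ℚ r := B.linearIndependent.map' V.subtype V.ker_subtype
  let E : Fin n → Fin (Module.finrank ℚ V) → ℚ := fun i =>
    B.repr ⟨d i, Submodule.subset_span ⟨i, rfl⟩⟩
  have hE : ∀ i, d i = ∑ k, (E i k : ℝ) * r k := by
    intro i
    have h := congrArg V.subtype (B.sum_repr ⟨d i, Submodule.subset_span ⟨i, rfl⟩⟩)
    rw [map_sum] at h
    simp only [map_smul, Rat.smul_def] at h
    exact h.symm
  -- the perturbed vector, as a function of the values given to the basis elements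
  let D : (Fin (Module.finrank ℚ V) → ℝ) → Fin n → ℝ := fun s i => ∑ k, (E i k : ℝ) * s k
  have hD : Continuous D := by fun_prop
  have hDr : D r = d := (funext hE).symm
  have hzero : ∀ j, dotProduct (fun i => (A j i : ℝ)) d = 0 →
      ∀ s, dotProduct (fun i => (A j i : ℝ)) (D s) = 0 := by
    intro j hj
    have hsum : ∀ s, dotProduct (fun i => (A j i : ℝ)) (D s) =
        ∑ k, ((∑ i, A j i * E i k : ℚ) : ℝ) * s k := by
      intro s
      simp only [dotProduct, D, Finset.mul_sum, Rat.cast_sum, Rat.cast_mul, Finset.sum_mul]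
      rw [Finset.sum_comm]
      simp only [mul_assoc]
    rw [← hDr, hsum] at hj
    have h0 := Fintype.linearIndependent_iff.1 hr (fun k => ∑ i, A j i * E i k)
      (by simpa only [Rat.smul_def] using hj)
    intro s
    rw [hsum]
    exact Finset.sum_eq_zero fun k _ => by rw [h0 k]; simp
  have hopen : ∀ᶠ s in 𝓝 r, D s ≠ 0 ∧ ∀ j, dotProduct (fun i => (A j i : ℝ)) d < 0 →
      dotProduct (fun i => (A j i : ℝ)) (D s) < 0 := by
    refine (hD.continuousAt.eventually_ne (by rwa [hDr])).and (eventually_all.2 fun j => ?_)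
    by_cases hj : dotProduct (fun i => (A j i : ℝ)) d < 0
    · have hc := (continuous_dotProduct_right (fun i => (A j i : ℝ))).comp hD
      have := (hc.tendsto r).eventually (gt_mem_nhds (by simpa [hDr] using hj))
      filter_upwards [this] with s hs _ using hs
    · simp [hj]
  obtain ⟨U, hU, hUo, hrU⟩ := eventually_nhds_iff.1 hopen
  obtain ⟨q, hq⟩ := (DenseRange.piMap (fun _ : Fin (Module.finrank ℚ V) =>
    (Rat.denseRange_cast : DenseRange ((↑) : ℚ → ℝ)))).exists_mem_open hUo ⟨r, hrU⟩
  obtain ⟨hne, hneg⟩ := hU _ hq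
  obtain ⟨⟨N, hN⟩, hint⟩ := IsLocalization.exist_integer_multiples (nonZeroDivisors ℤ)
    Finset.univ (fun i => ∑ k, E i k * q k)
  choose e he using fun i => hint i (Finset.mem_univ i)
  -- The common denominator N is only known to be nonzero; multiplying by it twice gives a positive
  -- factor, which preserves signs.
  have hN0 : (0 : ℝ) < (N : ℝ) * N :=
    mul_self_pos.2 (Int.cast_ne_zero.2 (nonZeroDivisors.ne_zero hN))
  have heD : (fun i => ((N * e i : ℤ) : ℝ)) =
      ((N : ℝ) * N) • D (Pi.map (fun _ => ((↑) : ℚ → ℝ)) q) := by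
    funext i
    have h := congrArg (fun x : ℚ => (x : ℝ)) (he i)
    simp only [algebraMap_int_eq, Int.coe_castRingHom, Rat.cast_intCast, zsmul_eq_mul,
      Rat.cast_mul, Rat.cast_sum] at h
    simp only [Int.cast_mul, h, Pi.smul_apply, smul_eq_mul, D, Pi.map_apply]
    ring
  refine ⟨fun i => N * e i, fun h0 => hne ?_, fun j => ⟨fun h => ?_, fun h => ?_⟩⟩
  · have : (fun i => ((N * e i : ℤ) : ℝ)) = 0 := by
      funext i
      have := congrFun h0 i
      simp only [Pi.zero_apply] at this ⊢
      rw [this, Int.cast_zero]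
    rw [heD] at this
    exact (smul_eq_zero.1 this).resolve_left hN0.ne'
  · rw [heD, dotProduct_smul, hzero j h, smul_zero]
  · rw [heD, dotProduct_smul, smul_eq_mul]
    exact mul_neg_of_pos_of_neg hN0 (hneg j h)

/-- An unbounded polyhedron has a nonzero recession direction. -/
theorem exists_recession_direction {n m : ℕ} (A : Fin m → Fin n → ℝ) (b : Fin m → ℝ)
    (hunb : ¬ Bornology.IsBounded {x | ∀ j, dotProduct (A j) x ≤ b j}) :
    ∃ d : Fin n → ℝ, d ≠ 0 ∧ ∀ j, dotProduct (A j) d ≤ 0 := by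
  have hex : ∀ k : ℕ, ∃ x, (∀ j, dotProduct (A j) x ≤ b j) ∧ (k : ℝ) < ‖x‖ := by
    intro k
    by_contra! hcon
    exact hunb (isBounded_iff_forall_norm_le.2 ⟨k, hcon⟩)
  choose x hx hxk using hex
  have hpos : ∀ k, 0 < ‖x k‖ := fun k => (Nat.cast_nonneg k).trans_lt (hxk k)
  -- Normalized points of the polyhedron accumulate on the unit sphere, and dividing by their norms
  -- sends the right-hand sides to 0.
  obtain ⟨d, hd, φ, hφ, hlim⟩ := (isCompact_sphere (0 : Fin n → ℝ) 1).tendsto_subseq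
    (x := fun k => ‖x k‖⁻¹ • x k) (fun k => by
      rw [mem_sphere_zero_iff_norm, norm_smul, norm_inv, norm_norm,
        inv_mul_cancel₀ (hpos k).ne'])
  refine ⟨d, ne_zero_of_mem_unit_sphere ⟨d, hd⟩, fun j => ?_⟩
  have hnorm : Tendsto (fun k => ‖x k‖) atTop atTop :=
    tendsto_atTop_mono (fun k => (hxk k).le) tendsto_natCast_atTop_atTop
  have h0 : Tendsto (fun k => ‖x (φ k)‖⁻¹ * b j) atTop (𝓝 0) := by
    simpa using (hnorm.inv_tendsto_atTop.comp hφ.tendsto_atTop).mul_const (b j)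
  refine le_of_tendsto_of_tendsto (((continuous_dotProduct_right (A j)).tendsto d).comp hlim) h0
    (Eventually.of_forall fun k => ?_)
  simp only [Function.comp_apply, dotProduct_smul, smul_eq_mul]
  exact mul_le_mul_of_nonneg_left (hx _ j) (inv_nonneg.2 (hpos _).le)

/-- A rational polyhedron containing an integral point is bounded as soon as its set of integral
points is. -/
theorem IsRationalPolyhedron.isBounded_of_isBounded_inter_intPoints {n : ℕ}
    {C : Set (Fin n → ℝ)} (hC : IsRationalPolyhedron C) (hne : (C ∩ intPoints n).Nonempty)
    (hb : Bornology.IsBounded (C ∩ intPoints n)) : Bornology.IsBounded C := by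
  obtain ⟨m, A, b, rfl⟩ := hC
  by_contra hunb
  obtain ⟨d, hd, hAd⟩ := exists_recession_direction _ _ hunb
  obtain ⟨e, he, heA⟩ := exists_int_vector_of_dotProduct_nonpos A hd
  obtain ⟨p, hpC, z, rfl⟩ := hne
  obtain ⟨R, hR⟩ := isBounded_iff_forall_norm_le.1 hb
  -- Following the integral recession direction e from an integer point gives an unbounded sequence
  -- of integer points.
  have hmem : ∀ k : ℕ, (fun i => ((z i + k * e i : ℤ) : ℝ)) ∈
      {x | ∀ j, dotProduct (fun i => (A j i : ℝ)) x ≤ (b j : ℝ)} ∩ intPoints n := by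
    refine fun k => ⟨fun j => ?_, _, rfl⟩
    have heq : (fun i => ((z i + k * e i : ℤ) : ℝ)) =
        (fun i => (z i : ℝ)) + (k : ℝ) • fun i => (e i : ℝ) := by
      funext i; simp
    have hej : dotProduct (fun i => (A j i : ℝ)) (fun i => (e i : ℝ)) ≤ 0 := by
      rcases (hAd j).eq_or_lt with h | h
      · exact ((heA j).1 h).le
      · exact ((heA j).2 h).le
    have hz := hpC j
    rw [heq, dotProduct_add, dotProduct_smul, smul_eq_mul]
    nlinarith [mul_nonneg (Nat.cast_nonneg (α := ℝ) k) (neg_nonneg.2 hej)]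
  obtain ⟨i, hi⟩ := Function.ne_iff.1 he
  obtain ⟨k, hk⟩ := exists_nat_gt (R + |(z i : ℝ)|)
  have h1 := (norm_le_pi_norm _ i).trans (hR _ (hmem k))
  have h2 : (1 : ℝ) ≤ |(e i : ℝ)| := by
    exact_mod_cast Int.one_le_abs hi
  have h3 : |(k : ℝ) * e i| ≤ |((z i + k * e i : ℤ) : ℝ)| + |(z i : ℝ)| := by
    have := abs_sub ((z i + k * e i : ℤ) : ℝ) (z i : ℝ)
    push_cast at this ⊢
    simpa using this
  rw [abs_mul, Nat.abs_cast] at h3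
  rw [Real.norm_eq_abs] at h1
  nlinarith [Nat.cast_nonneg (α := ℝ) k]

theorem finite_of_isBounded_of_subset_intPoints {n : ℕ} {P : Set (Fin n → ℝ)}
    (hP : P ⊆ intPoints n) (hb : Bornology.IsBounded P) : P.Finite := by
  obtain ⟨R, hR⟩ := isBounded_iff_forall_norm_le.1 hb
  refine ((Set.finite_Icc (fun _ : Fin n => -⌈R⌉) (fun _ => ⌈R⌉)).image
    (fun z i => (z i : ℝ))).subset fun x hx => ?_
  obtain ⟨z, rfl⟩ := hP hx
  have h : ∀ i, |z i| ≤ ⌈R⌉ := fun i => by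
    have := ((norm_le_pi_norm _ i).trans (hR _ hx)).trans (Int.le_ceil R)
    rw [Real.norm_eq_abs, ← Int.cast_abs] at this
    exact Int.cast_le.1 this
  exact ⟨z, ⟨fun i => (abs_le.1 (h i)).1, fun i => (abs_le.1 (h i)).2⟩, rfl⟩

/-- The face of a convex hull cut out by a valid inequality is the convex hull of the generators
lying on it. -/
theorem setOf_mem_convexHull_eq {n : ℕ} {P : Set (Fin n → ℝ)} {a : Fin n → ℝ} {b : ℝ}
    (hP : ∀ x ∈ P, dotProduct a x ≤ b) :
    {x ∈ convexHull ℝ P | dotProduct a x = b} =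
      convexHull ℝ {x ∈ P | dotProduct a x = b} := by
  apply Set.Subset.antisymm
  · rintro x ⟨hx, hxb⟩
    have hsub : convexHull ℝ P ⊆ {x | dotProduct a x ≤ b ∧
        (dotProduct a x = b → x ∈ convexHull ℝ {x ∈ P | dotProduct a x = b})} := by
      refine convexHull_min (fun x hx => ⟨hP x hx, fun h => subset_convexHull ℝ _ ⟨hx, h⟩⟩) ?_
      rintro x ⟨hx, hx'⟩ y ⟨hy, hy'⟩ s t hs ht hst
      simp only [Set.mem_ofPred_eq, dotProduct_add, dotProduct_smul, smul_eq_mul]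
      have hsx := mul_le_mul_of_nonneg_left hx hs
      have hty := mul_le_mul_of_nonneg_left hy ht
      have hb : s * b + t * b = b := by rw [← add_mul, hst, one_mul]
      refine ⟨by linarith, fun h => ?_⟩
      rcases hs.eq_or_lt with rfl | hs0
      · obtain rfl : t = 1 := by linarith
        simpa using hy' (by linarith)
      rcases ht.eq_or_lt with rfl | ht0
      · obtain rfl : s = 1 := by linarith
        simpa using hx' (by linarith)
      -- With both weights positive, tightness of the combination forces tightness at both
      -- endpoints.
      obtain rfl : t = 1 - s := by linarith
      exact convex_convexHull ℝ _ (hx' (by nlinarith)) (hy' (by nlinarith)) hs ht hst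
    exact (hsub hx).2 hxb
  · refine fun x hx => ⟨convexHull_mono (fun y hy => hy.1) hx, ?_⟩
    have hc : Convex ℝ {x : Fin n → ℝ | dotProduct a x = b} :=
      convex_hyperplane (dotProductBilin ℝ ℝ a).isLinear b
    exact convexHull_min (fun y hy => hy.2) hc hx

/-- A face of a polytope with integral vertices is defined by an integral inequality. -/
theorem DefinesFace.exists_int {n : ℕ} {P F : Set (Fin n → ℝ)} {a : Fin n → ℝ} {b : ℝ}
    (hPint : P ⊆ intPoints n) (hP : P.Finite) (hF : F.Nonempty)
    (h : DefinesFace (convexHull ℝ P) a b F) :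
    ∃ (α : Fin n → ℤ) (β : ℤ), α ≠ 0 ∧
      DefinesFace (convexHull ℝ P) (fun i => (α i : ℝ)) β F := by
  obtain ⟨ha, hsub, hFeq⟩ := h
  have hPa : ∀ x ∈ P, dotProduct a x ≤ b := fun x hx => hsub (subset_convexHull ℝ P hx)
  rw [setOf_mem_convexHull_eq hPa] at hFeq
  obtain ⟨z, hzP, hzb⟩ : {x ∈ P | dotProduct a x = b}.Nonempty := by
    rw [← convexHull_nonempty_iff (𝕜 := ℝ), ← hFeq]
    exact hF
  have hex : ∀ x : P, ∃ y : Fin n → ℤ, (fun i => (y i : ℝ)) = x := fun x => hPint x.2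
  choose f hf using hex
  have : Finite P := hP
  -- The forms x - z, with z on the face, take value 0 at a if x is tight and a negative value
  -- otherwise. An integral α with the same signs has the same tight points in P, hence the same
  -- face.
  let A : P → Fin n → ℚ := fun x i => ((f x i - f ⟨z, hzP⟩ i : ℤ) : ℚ)
  have hA : ∀ (x : P) (v : Fin n → ℝ),
      dotProduct (fun i => (A x i : ℝ)) v = dotProduct v x - dotProduct v z := by
    intro x v
    rw [dotProduct_comm, ← dotProduct_sub, ← hf x, ← show _ = z from hf ⟨z, hzP⟩]
    congr 1
    funext i
    simp [A]
  obtain ⟨α, hα, hsign⟩ := exists_int_vector_of_dotProduct_nonpos A ha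
  have hβ : dotProduct (fun i => (α i : ℝ)) z = ((dotProduct α (f ⟨z, hzP⟩) : ℤ) : ℝ) := by
    refine (congrArg _ (hf ⟨z, hzP⟩).symm).trans ?_
    simp [dotProduct]
  simp only [hA, hzb, sub_eq_zero, sub_neg] at hsign
  have hPα : ∀ x ∈ P, dotProduct (fun i => (α i : ℝ)) x ≤ (dotProduct α (f ⟨z, hzP⟩) : ℤ) := by
    intro x hx
    rw [← hβ]
    rcases (hPa x hx).eq_or_lt with h | h
    · exact ((hsign ⟨x, hx⟩).1 h).le
    · exact ((hsign ⟨x, hx⟩).2 h).le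
  refine ⟨α, dotProduct α (f ⟨z, hzP⟩), hα, fun h => hα ?_, ?_, ?_⟩
  · funext i
    exact Int.cast_eq_zero.1 (congrFun h i)
  · exact convexHull_min hPα (convex_halfSpace_le (dotProductBilin ℝ ℝ _).isLinear _)
  · rw [setOf_mem_convexHull_eq hPα, hFeq]
    congr 1
    ext x
    refine and_congr_right fun hx => ⟨fun h => ?_, fun h => ?_⟩
    · rw [← hβ]
      exact (hsign ⟨x, hx⟩).1 h
    · refine (hPa x hx).eq_or_lt.resolve_right fun hlt => ?_
      rw [← hβ] at h
      exact ((hsign ⟨x, hx⟩).2 hlt).ne h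

end Rational

/-! ### Branch-and-cut trees: leaves, integer points, transfer to longer lists. -/

theorem listInter_mono_of_sublist {n : ℕ} {L L' : List (Set (Fin n → ℝ))} (h : L.Sublist L') :
    listInter L' ⊆ listInter L := fun _ hx K hK => hx K (h.subset hK)

theorem listInter_cons_subset {n : ℕ} (K : Set (Fin n → ℝ)) (L : List (Set (Fin n → ℝ))) :
    listInter (K :: L) ⊆ listInter L := listInter_mono_of_sublist (List.sublist_cons_self K L)

theorem mem_listInter_cons {n : ℕ} {K : Set (Fin n → ℝ)} {L : List (Set (Fin n → ℝ))}
    {x : Fin n → ℝ} : x ∈ listInter (K :: L) ↔ x ∈ K ∧ x ∈ listInter L :=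
  List.forall_mem_cons

namespace BCTree

variable {n : ℕ}

theorem leafUnion_subset_listInter {Cert : Type u} (t : BCTree n Cert)
    (L : List (Set (Fin n → ℝ))) : t.leafUnion L ⊆ listInter L := by
  induction t generalizing L with
  | leaf => exact subset_rfl
  | branch D child ih =>
    exact Set.iUnion_subset fun i => (ih i _).trans (listInter_cons_subset _ _)
  | cut H c t ih => exact (ih _).trans (listInter_cons_subset _ _)

/-- Disjunctions cover ℤⁿ and cuts keep every integer point, so none is lost on the way to the
leaves. Hence the convex hull of the leaves contains the integer hull. -/
theorem listInter_inter_intPoints_subset_leafUnion (S : BranchAndCutScheme.{u} n)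
    (t : BCTree n S.Cert) (L : List (Set (Fin n → ℝ))) (ht : t.IsTree S L) :
    listInter L ∩ intPoints n ⊆ t.leafUnion L := by
  induction t generalizing L with
  | leaf => exact Set.inter_subset_left
  | branch D child ih =>
    rintro x ⟨hx, hxi⟩
    obtain ⟨-, hD, hchild⟩ := ht
    obtain ⟨K, hK, hxK⟩ := hD.2 x hxi
    obtain ⟨i, rfl⟩ := List.get_of_mem hK
    exact Set.mem_iUnion.2 ⟨i, ih i _ (hchild i) ⟨mem_listInter_cons.2 ⟨hxK, hx⟩, hxi⟩⟩
  | cut H c t ih =>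
    rintro x ⟨hx, hxi⟩
    obtain ⟨-, hH, -, ht⟩ := ht
    exact ih _ ht ⟨mem_listInter_cons.2 ⟨hH.2 ⟨hx, hxi⟩, hx⟩, hxi⟩

/-- A branch-and-cut tree can be transferred to a root with further constraints. -/
theorem IsTree.exists_of_sublist {S : BranchAndCutScheme.{u} n} (hmono : S.IsMonotone)
    (t : BCTree n S.Cert) {L L' : List (Set (Fin n → ℝ))} (hL : L.Sublist L')
    (ht : t.IsTree S L) : ∃ t' : BCTree n S.Cert, t'.IsTree S L' ∧
      t'.size S.certSize ≤ t.size S.certSize ∧ t'.leafUnion L' ⊆ t.leafUnion L := by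
  induction t generalizing L L' with
  | leaf => exact ⟨leaf, trivial, le_rfl, listInter_mono_of_sublist hL⟩
  | branch D child ih =>
    obtain ⟨hDS, hD, hchild⟩ := ht
    choose f hf hsize hsub using fun i => ih i (hL.cons_cons (D.get i)) (hchild i)
    exact ⟨branch D f, ⟨hDS, hD, hf⟩, Nat.add_le_add_left (Finset.sum_le_sum fun i _ => hsize i) 1,
      Set.iUnion_mono hsub⟩
  | cut H c t ih =>
    obtain ⟨hHS, hH, hc, ht⟩ := ht
    obtain ⟨t', ht', hsize, hsub⟩ := ih (hL.cons_cons H) ht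
    obtain ⟨c', hc', hcs⟩ := (hmono _ _ (hL.cons_cons Hᶜ)).2 c hc
    refine ⟨cut H c' t', ⟨(hmono _ _ hL).1 hHS, ⟨hH.1, ?_⟩, hc', ht'⟩, ?_, hsub⟩
    · exact (Set.inter_subset_inter_left _ (listInter_mono_of_sublist hL)).trans hH.2
    · simp only [size]
      omega

end BCTree

theorem isValidDisjunction_splitDisjunction {n : ℕ} (α : Fin n → ℤ) (β : ℤ) :
    IsValidDisjunction (splitDisjunction α β) := by
  refine ⟨?_, ?_⟩
  · simp only [splitDisjunction, List.forall_mem_cons, List.not_mem_nil, IsEmpty.forall_iff,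
      implies_true, and_true]
    exact ⟨convex_halfSpace_le (dotProductBilin ℝ ℝ _).isLinear _,
      convex_halfSpace_ge (dotProductBilin ℝ ℝ _).isLinear _⟩
  · rintro _ ⟨z, rfl⟩
    have h : dotProduct (fun i => (α i : ℝ)) (fun i => (z i : ℝ)) =
        ((dotProduct α z : ℤ) : ℝ) := by simp [dotProduct]
    simp only [splitDisjunction, List.exists_mem_cons_iff, Set.mem_ofPred_eq, h]
    rcases le_or_gt (dotProduct α z) β with hle | hgt
    · exact Or.inl (by exact_mod_cast hle)
    · exact Or.inr (Or.inl (by exact_mod_cast hgt))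

/-! ### The upper bound on the facet complexity. -/

/-- Slightly beyond a relative interior point of a facet lies a point that belongs to every
pyramid over the facet whose apex ranges over a bounded set beyond the facet. -/
theorem exists_mem_convexHull_insert {n : ℕ} {F B : Set (Fin n → ℝ)} {a : Fin n → ℝ} {b : ℝ}
    (ha : a ≠ 0) (hF : Convex ℝ F) (hne : F.Nonempty) (hFb : ∀ x ∈ F, dotProduct a x = b)
    (hspan : orthHyperplane a ≤ vectorSpan ℝ F) (hB : Bornology.IsBounded B) :
    ∃ x, b < dotProduct a x ∧
      ∀ q ∈ B, b + 1 ≤ dotProduct a q → x ∈ convexHull ℝ (insert q F) := by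
  obtain ⟨w, hw⟩ := hne.intrinsicInterior hF
  have hwF : w ∈ F := intrinsicInterior_subset hw
  obtain ⟨y, hy, rfl⟩ := mem_intrinsicInterior.1 hw
  obtain ⟨r, hr, hball⟩ := Metric.mem_nhds_iff.1 (mem_interior_iff_mem_nhds.1 hy)
  set w : Fin n → ℝ := (y : Fin n → ℝ) with hwdef
  have hmem : ∀ v ∈ orthHyperplane a, ‖v‖ < r → v + w ∈ F := by
    intro v hv hvr
    have hvs : v + w ∈ affineSpan ℝ F := AffineSubspace.vadd_mem_of_mem_direction
      (by rw [direction_affineSpan]; exact hspan hv) y.2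
    have : (⟨v + w, hvs⟩ : affineSpan ℝ F) ∈ Metric.ball y r := by
      rw [Metric.mem_ball, Subtype.dist_eq, dist_eq_norm]
      simpa [hwdef] using hvr
    exact hball this
  obtain ⟨R, hR⟩ := (Metric.isBounded_iff_subset_closedBall w).1 hB
  have hc := dotProduct_self_pos_of_ne_zero ha
  set c := dotProduct a a with hcdef
  have hwb := hFb w hwF
  -- The first bound keeps the weight l of the apex below 1/2, so that (1 - l)⁻¹ ≤ 2; the second
  -- then keeps the base point within r of w, uniformly in q.
  have hev : ∀ᶠ δ : ℝ in 𝓝[>] 0, δ * c < 1 / 2 ∧ 2 * (δ * ‖a‖ + δ * c * R) < r := by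
    refine nhdsWithin_le_nhds (Eventually.and ?_ ?_)
    · have : Continuous fun δ : ℝ => δ * c := by fun_prop
      exact (this.tendsto 0).eventually (gt_mem_nhds (by norm_num))
    · have : Continuous fun δ : ℝ => 2 * (δ * ‖a‖ + δ * c * R) := by fun_prop
      exact (this.tendsto 0).eventually (gt_mem_nhds (by simpa using hr))
  obtain ⟨δ, ⟨hδc, hδr⟩, hδ⟩ := (hev.and self_mem_nhdsWithin).exists
  have hδ : 0 < δ := hδ
  refine ⟨w + δ • a, ?_, fun q hq hqb => ?_⟩
  · rw [dotProduct_add, dotProduct_smul, hwb, smul_eq_mul]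
    nlinarith
  have hqR : ‖q - w‖ ≤ R := by
    have := hR hq
    rwa [Metric.mem_closedBall, dist_eq_norm] at this
  have hR0 : 0 ≤ R := (norm_nonneg _).trans hqR
  have hden : 0 < dotProduct a q - b := by linarith
  -- The weight for which removing the apex's share from w + δa leaves a point on the hyperplane of
  -- F.
  set l := δ * c / (dotProduct a q - b) with hl
  have hl0 : 0 ≤ l := div_nonneg (mul_pos hδ hc).le hden.le
  have hlc : l ≤ δ * c := div_le_self (mul_pos hδ hc).le (by linarith)
  have hl1 : 0 < 1 - l := by linarith
  have hinv : (1 - l)⁻¹ ≤ 2 := by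
    rw [inv_le_comm₀ hl1 two_pos]
    linarith
  set v := (1 - l)⁻¹ • (δ • a - l • (q - w)) with hv
  have hvF : v + w ∈ F := by
    apply hmem
    · rw [hv]
      refine Submodule.smul_mem _ _ ?_
      rw [mem_orthHyperplane, dotProduct_sub, dotProduct_smul, dotProduct_smul, dotProduct_sub,
        hwb, smul_eq_mul, smul_eq_mul, hl, div_mul_cancel₀ _ hden.ne', sub_self]
    · have h1 : ‖δ • a - l • (q - w)‖ ≤ δ * ‖a‖ + δ * c * R := by
        refine (norm_sub_le _ _).trans (add_le_add ?_ ?_)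
        · rw [norm_smul, Real.norm_of_nonneg hδ.le]
        · rw [norm_smul, Real.norm_of_nonneg hl0]
          exact mul_le_mul hlc hqR (norm_nonneg _) (hl0.trans hlc)
      rw [hv, norm_smul, Real.norm_of_nonneg (inv_nonneg.2 hl1.le)]
      exact (mul_le_mul hinv h1 (norm_nonneg _) zero_le_two).trans_lt hδr
  have hx : w + δ • a = (1 - l) • (v + w) + l • q := by
    rw [hv, smul_add, smul_smul, mul_inv_cancel₀ hl1.ne']
    module
  rw [hx]
  exact convex_convexHull ℝ _ (subset_convexHull ℝ _ (Set.mem_insert_of_mem _ hvF))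
    (subset_convexHull ℝ _ (Set.mem_insert _ _)) hl1.le hl0 (by ring)

theorem BranchAndCutScheme.facetComplexity_le_membershipComplexity_add_two {n : ℕ}
    (S : BranchAndCutScheme.{u} n) (hmono : S.IsMonotone) (hsplit : S.AllowsSplits)
    (L : List (Set (Fin n → ℝ))) (hbdd : Bornology.IsBounded (listInter L))
    (hfull : affineSpan ℝ (integerHull L) = ⊤) :
    S.facetComplexity L ≤ S.membershipComplexity L + 2 := by
  refine iSup₂_le fun F hF => ?_
  obtain ⟨hFne, ⟨a, b, hab⟩, hdim⟩ := hF
  obtain ⟨α, β, hα, hαβ⟩ := hab.exists_int Set.inter_subset_right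
    (finite_of_isBounded_of_subset_intPoints Set.inter_subset_right
      (hbdd.subset Set.inter_subset_left)) hFne
  refine (iInf_le_of_le (fun i => (α i : ℝ)) (iInf₂_le (β : ℝ) hαβ)).trans ?_
  obtain ⟨ha, hsub, hFeq⟩ := hαβ
  set a' : Fin n → ℝ := fun i => (α i : ℝ) with ha'
  have hFb : ∀ x ∈ F, dotProduct a' x = β := fun x hx => by
    rw [hFeq] at hx
    exact hx.2
  have hFconv : Convex ℝ F := by
    rw [hFeq]
    exact (convex_convexHull ℝ _).inter (convex_hyperplane (dotProductBilin ℝ ℝ a').isLinear _)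
  have hspan : vectorSpan ℝ F = orthHyperplane a' := by
    refine Submodule.eq_of_le_of_finrank_eq (vectorSpan_le_orthHyperplane hFb) ?_
    have h1 := finrank_orthHyperplane ha
    have h2 : Module.finrank ℝ (vectorSpan ℝ (integerHull L)) = n :=
      finrank_vectorSpan_of_affineSpan_eq_top hfull
    omega
  obtain ⟨x, hxb, hx⟩ := exists_mem_convexHull_insert ha hFconv hFne hFb hspan.ge hbdd
  have hxI : x ∉ integerHull L := fun h => hxb.not_ge (hsub h)
  refine le_trans ?_ (add_le_add_left
    (le_iSup₂ (f := fun y (_ : y ∉ integerHull L) => S.pointMembershipComplexity L y) x hxI) 2)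
  -- Moving the 2 to the left exposes the infimum, so that a single tree can be treated.
  rw [← tsub_le_iff_right]
  refine le_iInf₂ fun t ht => ?_
  rw [tsub_le_iff_right]
  obtain ⟨htree, hxt⟩ := ht
  obtain ⟨t', ht', hsize, hsub'⟩ := htree.exists_of_sublist hmono t
    (List.sublist_cons_self {y | (β : ℝ) + 1 ≤ dotProduct a' y} L)
  -- A surviving q would be an admissible apex beyond F; as q and F both lie in the convex hull of
  -- the leaves of t, so would x.
  have hempty : t'.leafUnion ({y | (β : ℝ) + 1 ≤ dotProduct a' y} :: L) = ∅ := by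
    refine Set.eq_empty_of_forall_notMem fun q hq => hxt ?_
    obtain ⟨hqβ, hqL⟩ := mem_listInter_cons.1 (t'.leafUnion_subset_listInter _ hq)
    refine convexHull_min (Set.insert_subset (subset_convexHull ℝ _ (hsub' hq)) ?_)
      (convex_convexHull ℝ _) (hx q hqL hqβ)
    rw [hFeq]
    exact fun y hy => convexHull_mono
      (t.listInter_inter_intPoints_subset_leafUnion S L htree) hy.1
  -- The side ⟨α, x⟩ ≤ β needs no further work, so the root and this leaf are the only additional
  -- nodes.
  let T : BCTree n S.Cert := .branch (splitDisjunction α β) (Fin.cons .leaf fun _ => t')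
  have hT : T.IsTree S L :=
    ⟨hsplit α β hα, isValidDisjunction_splitDisjunction α β,
      Fin.forall_fin_two.2 ⟨trivial, ht'⟩⟩
  have hTsub : T.leafUnion L ⊆ closedHalfspace a' β := by
    refine Set.iUnion_subset (Fin.forall_fin_two.2 ⟨?_, ?_⟩)
    · exact fun y hy => (mem_listInter_cons.1 hy).1
    · exact hempty.subset.trans (Set.empty_subset _)
  have hTsize : T.size S.certSize = 1 + (1 + t'.size S.certSize) := by
    change 1 + _ = _
    congr 1
  refine (iInf₂_le T ⟨hT, hTsub⟩).trans ?_
  rw [hTsize]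
  have : 1 + (1 + t'.size S.certSize) ≤ t.size S.certSize + 2 := by omega
  exact_mod_cast this

theorem mainTheorem5 {n : ℕ} (S : BranchAndCutScheme.{u} n)
    (hmono : S.IsMonotone) (hsplit : S.AllowsSplits)
    (L : List (Set (Fin n → ℝ))) (hconv : ∀ K ∈ L, Convex ℝ K)
    (hpoly : IsPolyhedron (listInter L))
    (hrat : IsRationalPolyhedron (listInter L) ∨ Bornology.IsBounded (listInter L))
    (hhull : IsRationalPolytope (BranchAndCutScheme.integerHull L))
    (hfull : affineSpan ℝ (BranchAndCutScheme.integerHull L) = ⊤) :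
    S.membershipComplexity L ≤ S.facetComplexity L ∧
      S.facetComplexity L ≤ S.membershipComplexity L + 2 := by
  refine ⟨S.membershipComplexity_le_facetComplexity L hhull.1.isPolyhedron hfull,
    S.facetComplexity_le_membershipComplexity_add_two hmono hsplit L ?_ hfull⟩
  refine hrat.elim (fun h => h.isBounded_of_isBounded_inter_intPoints ?_ ?_) id
  -- Full-dimensionality supplies the integer point needed to start the integral ray.
  · rw [← convexHull_nonempty_iff (𝕜 := ℝ), ← affineSpan_nonempty (k := ℝ)]
    have : affineSpan ℝ (convexHull ℝ (listInter L ∩ intPoints n)) = ⊤ := hfull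
    rw [this]
    exact ⟨0, trivial⟩
  · exact hhull.2.subset (subset_convexHull ℝ _)
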